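/- Identify real functions on the unit circle with $2\pi$-periodic functions $f(\theta)$ of the angle. Let $N_f$ be the set of points of the circle such that $f$ is not Lebesgue integrable on any neighbourhood of the point (the non-integrable singularities of $f$). Call $f$ locally integrable almost everywhere on the circle if $N_f$ is finite and $f$ is integrable on every closed interval that contains no point of $N_f$; globally integrable functions are included. An inner analytic function is a function analytic in the open unit disk. Its angular derivative is $i z\,w'(z)$ and its angular primitive is $-i\int_0^z \frac{w(z')-w(0)}{z'}\,dz'$. A hard singularity of $w$ is a point $z_1$ with $|z_1|=1$ at which $w(z)$ has no finite limit as $z\to z_1$ within the open disk. It is borderline hard if the angular primitive of $w$ has a finite limit at $z_1$. It has degree of hardness $n\ge 0$ if the $n$-fold angular primitive of $w$ has a borderline hard singularity at $z_1$. To an integrable $F$ on the circle corresponds the inner analytic function $W_F(z)=\sum_{k\ge 0}c_kz^k$ with $c_0=\alpha_0/2$ and $c_k=\alpha_k-i\beta_k$ for $k\ge1$, where $\alpha_k=\frac1\pi\int_{-\pi}^{\pi}\cos(k\theta)F(\theta)\,d\theta$ and $\beta_k=\frac1\pi\int_{-\pi}^{\pi}\sin(k\theta)F(\theta)\,d\theta$.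 More generally, an inner analytic function $w$ is said to correspond to $f$ if there are a real constant $c$, an integer $n\ge 0$ and an integrable function $F$ on the circle such that $F$ is an $n$-fold piecewise primitive of $f-c$ (for $n=0$ this means $F=f-c$; for $n\ge 1$, $F$ is obtained from $f-c$ by $n$ successive integrations in $\theta$ on each arc between points of $N_f$, with independent integration constants on the various arcs), and $w-c$ is the $n$-fold angular derivative of $W_F$. If $f$ is integrable, the only such $w$ is $W_f$. **Theorem.** Let $f$ be a real function on the unit circle that is locally integrable almost everywhere there, and let $w$ be an inner analytic function corresponding to $f$. Suppose that $w$ has only finitely many hard singularities on the unit circle, and that each of them has a finite degree of hardness. Then there is a solution of the Dirichlet problem on the unit disk with boundary values $f$: there is a function $u$, harmonic in the open unit disk, such that $$\lim_{\rho\to1^-}u(\rho e^{i\theta})=f(\theta)\qquad\text{for almost every }\theta ;$$ in fact $u=\operatorname{Re} w$ has this property. -/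

import Mathlib

open Filter Topology MeasureTheory

noncomputable section

namespace DiskDirichlet

/-! Functions on the unit circle are written as `2π`-periodic functions of the angle `θ : ℝ`.
Inner analytic functions are functions `w : ℂ → ℂ` of which only the restriction to the open
unit disk `Metric.ball 0 1` matters. -/

/-! ### Angular calculus and the classification of singularities -/

/-- The angular derivative `i z w'(z)`. -/
def angularDeriv (w : ℂ → ℂ) (z : ℂ) : ℂ :=
  Complex.I * z * deriv w z

/-- The angular primitive `-i ∫_0^z (w(z') - w(0)) / z' dz'`, the integral being taken along the
segment `z' = t z`, `0 ≤ t ≤ 1`. -/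
def angularPrimitive (w : ℂ → ℂ) (z : ℂ) : ℂ :=
  -Complex.I * ∫ t in (0 : ℝ)..1, (w (t * z) - w 0) / (t * z) * z

/-- `w` has a finite limit at `z`, taken from within the open unit disk. -/
def HasFiniteLimitAt (w : ℂ → ℂ) (z : ℂ) : Prop :=
  ∃ a : ℂ, Tendsto w (𝓝[Metric.ball 0 1] z) (𝓝 a)

/-- A hard singularity of `w`: a point of the unit circle at which `w` has no finite limit
(in particular `w` has no analytic continuation across such a point). -/
def IsHardSingularity (w : ℂ → ℂ) (z : ℂ) : Prop :=
  ‖z‖ = 1 ∧ ¬ HasFiniteLimitAt w z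

/-- A borderline hard singularity: a hard one that becomes soft by one angular integration. -/
def IsBorderlineHard (w : ℂ → ℂ) (z : ℂ) : Prop :=
  IsHardSingularity w z ∧ HasFiniteLimitAt (angularPrimitive w) z

/-- The hard singularity `z` of `w` has degree of hardness `n`: `n` angular integrations turn it
into a borderline hard singularity. -/
def HasDegreeOfHardness (w : ℂ → ℂ) (z : ℂ) (n : ℕ) : Prop :=
  IsHardSingularity w z ∧ IsBorderlineHard (angularPrimitive^[n] w) z

/-! ### Real functions on the unit circle -/

/-- The points at which `f` has a non-integrable singularity: `f` is not Lebesgue integrable on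
any neighbourhood of them. -/
def nonintegrableSet (f : ℝ → ℝ) : Set ℝ :=
  {θ | ¬ IntegrableAtFilter f (𝓝 θ) volume}

/-- `f` is locally integrable almost everywhere on the unit circle: it has finitely many
non-integrable singularities on the circle, and it is integrable on every closed interval that
contains none of them. -/
def LocallyIntegrableAE (f : ℝ → ℝ) : Prop :=
  (nonintegrableSet f ∩ Set.Ico 0 (2 * Real.pi)).Finite ∧
    ∀ a b : ℝ, Disjoint (Set.Icc a b) (nonintegrableSet f) → IntegrableOn f (Set.Icc a b) volume

/-! ### The inner analytic function of an integrable real function -/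

/-- The Fourier coefficient `α_k`. -/
def fourierCos (f : ℝ → ℝ) (k : ℕ) : ℝ :=
  (1 / Real.pi) * ∫ θ in (-Real.pi)..Real.pi, Real.cos (k * θ) * f θ

/-- The Fourier coefficient `β_k`. -/
def fourierSin (f : ℝ → ℝ) (k : ℕ) : ℝ :=
  (1 / Real.pi) * ∫ θ in (-Real.pi)..Real.pi, Real.sin (k * θ) * f θ

/-- The Taylor coefficients `c_0 = α_0 / 2` and `c_k = α_k - i β_k` for `k ≥ 1`. -/
def taylorCoeff (f : ℝ → ℝ) (k : ℕ) : ℂ :=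
  if k = 0 then (fourierCos f 0 : ℂ) / 2
  else (fourierCos f k : ℂ) - Complex.I * (fourierSin f k : ℂ)

/-- The inner analytic function `∑ c_k z^k` of an integrable real function on the circle. -/
def innerAnalyticOfIntegrable (f : ℝ → ℝ) (z : ℂ) : ℂ :=
  ∑' k : ℕ, taylorCoeff f k * z ^ k

/-! ### The inner analytic function of a non-integrable real function -/

/-- `G` is a piecewise primitive of `g` on the circle with the points of `S` removed: it is a
primitive of `g` on every closed interval without points of `S`, with independent integration
constants on the various arcs between points of `S`. -/
def IsPiecewisePrimitive (S : Set ℝ) (G g : ℝ → ℝ) : Prop :=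
  Function.Periodic G (2 * Real.pi) ∧
    ∀ a b : ℝ, a ≤ b → Disjoint (Set.Icc a b) S →
      IntervalIntegrable g volume a b ∧ G b - G a = ∫ θ in a..b, g θ

/-- `G` is an `n`-fold piecewise primitive of `g`. -/
def IsIteratedPiecewisePrimitive (S : Set ℝ) : ℕ → (ℝ → ℝ) → (ℝ → ℝ) → Prop
  | 0, G, g => G = g
  | n + 1, G, g => ∃ H : ℝ → ℝ, IsIteratedPiecewisePrimitive S n H g ∧ IsPiecewisePrimitive S G H

/-- `w` is an inner analytic function that corresponds to the real function `f`: after removal of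
a constant `c`, `f` is integrated piecewise `n` times, until a globally integrable function `F` on
the circle results; the inner analytic function of `F` is differentiated `n` times with respect to
the angle, and the constant is restored. For a globally integrable `f` there are no points to be
removed, and every choice leads to the inner analytic function of `f` itself. -/
def IsInnerAnalyticOf (f : ℝ → ℝ) (w : ℂ → ℂ) : Prop :=
  ∃ (c : ℝ) (n : ℕ) (F : ℝ → ℝ),
    IsIteratedPiecewisePrimitive (nonintegrableSet f) n F (fun θ => f θ - c) ∧
    IntervalIntegrable F volume (-Real.pi) Real.pi ∧
    Set.EqOn w (fun z => (c : ℂ) + (angularDeriv^[n] (innerAnalyticOfIntegrable F)) z)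
      (Metric.ball 0 1)

end DiskDirichlet

end

noncomputable section

namespace DiskDirichlet

/-! The real part of the `n`-fold angular derivative of `W_F` at `ρ e^{iθ}` is `1/(2π)` times the
integral of `P_n(θ - φ) F(φ)`, where `P_n` is the `n`-th derivative in the angle of the Poisson
kernel (`re_iterate_angularDeriv_innerAnalytic`). Every `P_n` tends to zero as `ρ → 1`, boundedly on
closed arcs avoiding angle zero, so only an interval `[θ - δ, θ + δ]` matters
(`tendsto_integral_poissonDeriv_away`).

For almost every `θ` this interval can be chosen free of non-integrable singularities. There `F` is
a genuine `n`-fold primitive of `f - c`, whatever constants were chosen on the other arcs, and `n`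
integrations by parts bring the integral back to `P_0` against `f - c`; the boundary terms sit away
from `θ` and disappear (`tendsto_integral_poissonDeriv_of_primitive`). Fatou's theorem, in the local
form `tendsto_integral_poissonDeriv_zero_mul`, then gives the limit `f(θ) - c` wherever the integral
of `f` has derivative `f(θ)`. By Lebesgue's differentiation theorem, that is almost everywhere.
Adding `c` back finishes the proof. -/

/-! ### The Poisson kernel and its angular derivatives -/

/-- The Schwarz kernel `(1 + z) / (1 - z)`. -/
def schwarzKernel (z : ℂ) : ℂ := (1 + z) / (1 - z)

/-- The point of the plane with polar coordinates `ρ` and `s`. -/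
def polarPoint (ρ s : ℝ) : ℂ := ρ * Complex.exp (s * Complex.I)

/-- The `n`-th angular derivative of the Poisson kernel at `ρ e^{is}`. -/
def poissonDeriv (n : ℕ) (ρ s : ℝ) : ℝ := (angularDeriv^[n] schwarzKernel (polarPoint ρ s)).re

lemma analyticOnNhd_iterate_angularDeriv {U : Set ℂ} {g : ℂ → ℂ} (hg : AnalyticOnNhd ℂ g U)
    (n : ℕ) : AnalyticOnNhd ℂ (angularDeriv^[n] g) U := by
  induction n with
  | zero => exact hg
  | succ n ih =>
    rw [Function.iterate_succ_apply']
    exact (analyticOnNhd_const.mul analyticOnNhd_id).mul ih.deriv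

lemma analyticOnNhd_schwarzKernel : AnalyticOnNhd ℂ schwarzKernel {1}ᶜ := by
  intro z hz
  refine (analyticAt_const.add analyticAt_id).div (analyticAt_const.sub analyticAt_id) ?_
  exact sub_ne_zero.2 (Ne.symm hz)

lemma analyticAt_iterate_schwarzKernel (n : ℕ) {z : ℂ} (hz : z ≠ 1) :
    AnalyticAt ℂ (angularDeriv^[n] schwarzKernel) z :=
  analyticOnNhd_iterate_angularDeriv analyticOnNhd_schwarzKernel n z hz

lemma norm_polarPoint (ρ s : ℝ) : ‖polarPoint ρ s‖ = |ρ| := by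
  simp [polarPoint, Complex.norm_exp_ofReal_mul_I]

lemma polarPoint_ne_one {ρ : ℝ} (hρ : |ρ| < 1) (s : ℝ) : polarPoint ρ s ≠ 1 := fun h => by
  have := norm_polarPoint ρ s
  rw [h, norm_one] at this
  linarith

lemma continuous_polarPoint : Continuous fun p : ℝ × ℝ => polarPoint p.1 p.2 := by
  unfold polarPoint
  fun_prop

lemma hasDerivAt_polarPoint (ρ s : ℝ) :
    HasDerivAt (polarPoint ρ) (Complex.I * polarPoint ρ s) s := by
  have h1 : HasDerivAt (fun s : ℝ => (s : ℂ) * Complex.I) (1 * Complex.I) s :=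
    (Complex.ofRealCLM.hasDerivAt).mul_const _
  refine ((h1.cexp).const_mul (ρ : ℂ)).congr_deriv ?_
  rw [polarPoint]
  ring

/-- Since `d/ds (ρ e^{is}) = i ρ e^{is}`, the chain rule turns `angularDeriv` into `d/ds`. The case
`ρ = 1` is included, for use on the boundary circle. -/
lemma hasDerivAt_poissonDeriv (n : ℕ) {ρ s : ℝ} (h : polarPoint ρ s ≠ 1) :
    HasDerivAt (poissonDeriv n ρ) (poissonDeriv (n + 1) ρ s) s := by
  have h1 := (analyticAt_iterate_schwarzKernel n h).differentiableAt.hasDerivAt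
  have h2 := h1.comp s (hasDerivAt_polarPoint ρ s)
  refine (Complex.reCLM.hasFDerivAt.comp_hasDerivAt s h2).congr_deriv ?_
  rw [poissonDeriv, Function.iterate_succ_apply', angularDeriv, Complex.reCLM_apply]
  congr 1
  ring

lemma continuousAt_poissonDeriv (n : ℕ) {p : ℝ × ℝ} (h : polarPoint p.1 p.2 ≠ 1) :
    ContinuousAt (fun p : ℝ × ℝ => poissonDeriv n p.1 p.2) p := by
  have h1 := (analyticAt_iterate_schwarzKernel n h).continuousAt
  exact Complex.continuous_re.continuousAt.comp
    (ContinuousAt.comp (f := fun p : ℝ × ℝ => polarPoint p.1 p.2) h1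
      continuous_polarPoint.continuousAt)

lemma continuous_poissonDeriv (n : ℕ) {ρ : ℝ} (hρ : |ρ| < 1) : Continuous (poissonDeriv n ρ) :=
  continuous_iff_continuousAt.2 fun _ =>
    (hasDerivAt_poissonDeriv n (polarPoint_ne_one hρ _)).continuousAt

lemma re_schwarzKernel (z : ℂ) : (schwarzKernel z).re = (1 - ‖z‖ ^ 2) / ‖1 - z‖ ^ 2 := by
  rw [schwarzKernel, Complex.div_re, ← Complex.normSq_eq_norm_sq, ← Complex.normSq_eq_norm_sq,
    ← add_div]
  congr 1
  simp [Complex.normSq_apply]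
  ring

lemma poissonDeriv_zero (ρ s : ℝ) :
    poissonDeriv 0 ρ s = (1 - ρ ^ 2) / ‖1 - polarPoint ρ s‖ ^ 2 := by
  simp [poissonDeriv, re_schwarzKernel, norm_polarPoint]

lemma poissonDeriv_zero_nonneg {ρ : ℝ} (hρ : |ρ| < 1) (s : ℝ) : 0 ≤ poissonDeriv 0 ρ s := by
  rw [poissonDeriv_zero]
  have : ρ ^ 2 < 1 := (sq_lt_one_iff_abs_lt_one ρ).2 hρ
  exact div_nonneg (by linarith) (by positivity)

/-- The numerator `1 - ρ ^ 2` kills the Poisson kernel on the circle off the point `1`, and the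
higher kernels are its tangential derivatives there. -/
lemma poissonDeriv_one_left (n : ℕ) {s : ℝ} (h : polarPoint 1 s ≠ 1) : poissonDeriv n 1 s = 0 := by
  induction n generalizing s with
  | zero => simp [poissonDeriv_zero]
  | succ n ih =>
    refine (hasDerivAt_poissonDeriv n h).unique ?_
    refine (hasDerivAt_const s (0 : ℝ)).congr_of_eventuallyEq ?_
    have hc : ContinuousAt (polarPoint 1) s := (hasDerivAt_polarPoint 1 s).continuousAt
    filter_upwards [hc.eventually_ne h] with t ht using ih ht

lemma deriv_schwarzKernel {z : ℂ} (hz : z ≠ 1) : deriv schwarzKernel z = 2 / (1 - z) ^ 2 := by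
  have h : (1 : ℂ) - z ≠ 0 := sub_ne_zero.2 hz.symm
  have := ((hasDerivAt_id z).const_add 1).div ((hasDerivAt_id z).const_sub 1) h
  refine (HasDerivAt.deriv (f := schwarzKernel) this).trans ?_
  congr 1
  simp
  ring

/-- The Schwarz kernel `y` satisfies the Riccati equation `i z y' = i (y² - 1) / 2`, whose real part
is `-Re y · Im y`. The Poisson kernel thus appears as a factor of its own derivative. -/
lemma poissonDeriv_one {ρ s : ℝ} (h : polarPoint ρ s ≠ 1) :
    poissonDeriv 1 ρ s = - poissonDeriv 0 ρ s * (schwarzKernel (polarPoint ρ s)).im := by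
  have h' : (1 : ℂ) - polarPoint ρ s ≠ 0 := sub_ne_zero.2 h.symm
  have key : angularDeriv schwarzKernel (polarPoint ρ s)
      = Complex.I * (schwarzKernel (polarPoint ρ s) ^ 2 - 1) / 2 := by
    rw [angularDeriv, deriv_schwarzKernel h, schwarzKernel]
    field_simp
    ring
  have : poissonDeriv 1 ρ s = (angularDeriv schwarzKernel (polarPoint ρ s)).re := rfl
  rw [this, key, poissonDeriv, Function.iterate_zero, id]
  generalize schwarzKernel (polarPoint ρ s) = y
  have : Complex.I * (y ^ 2 - 1) / 2 = ((1 / 2 : ℝ) : ℂ) * (Complex.I * (y ^ 2 - 1)) := by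
    push_cast; ring
  rw [this, Complex.re_ofReal_mul]
  simp [pow_two]
  ring

lemma norm_one_sub_polarPoint_sq (ρ s : ℝ) :
    ‖1 - polarPoint ρ s‖ ^ 2 = (1 - ρ) ^ 2 + 4 * ρ * Real.sin (s / 2) ^ 2 := by
  rw [← Complex.normSq_eq_norm_sq, Complex.normSq_apply]
  have h1 : (polarPoint ρ s).re = ρ * Real.cos s := by
    rw [polarPoint, Complex.re_ofReal_mul, Complex.exp_ofReal_mul_I_re]
  have h2 : (polarPoint ρ s).im = ρ * Real.sin s := by
    rw [polarPoint, Complex.im_ofReal_mul, Complex.exp_ofReal_mul_I_im]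
  have h3 : Real.cos s = 1 - 2 * Real.sin (s / 2) ^ 2 := by
    have := Real.cos_two_mul (s / 2)
    rw [mul_div_cancel₀ s two_ne_zero] at this
    rw [this, Real.cos_sq']
    ring
  have h4 := Real.sin_sq_add_cos_sq s
  simp only [Complex.sub_re, Complex.sub_im, Complex.one_re, Complex.one_im, h1, h2]
  linear_combination ρ ^ 2 * h4 - 2 * ρ * h3

/-- Jordan's inequality gives `|s| ≤ π |sin (s/2)|`, and `ρ ≥ 1/2` makes the coefficient `4ρ` in
`norm_one_sub_polarPoint_sq` at least `1`. -/
lemma abs_le_mul_norm_one_sub_polarPoint {ρ s : ℝ} (hρ : 1 / 2 ≤ ρ) (hs : |s| ≤ Real.pi) :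
    |s| ≤ Real.pi * ‖1 - polarPoint ρ s‖ := by
  refine abs_le_of_sq_le_sq' ?_ (by positivity) |>.2
  have h := Real.mul_abs_le_abs_sin (x := s / 2) (by rw [abs_div, abs_two]; linarith)
  rw [abs_div, abs_two] at h
  have h2 : |s| ≤ Real.pi * |Real.sin (s / 2)| := by
    have := Real.pi_pos
    calc |s| = Real.pi * (2 / Real.pi * (|s| / 2)) := by field_simp
      _ ≤ _ := by gcongr
  calc |s| ^ 2 ≤ (Real.pi * |Real.sin (s / 2)|) ^ 2 := by gcongr
    _ = Real.pi ^ 2 * Real.sin (s / 2) ^ 2 := by rw [mul_pow, sq_abs]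
    _ ≤ Real.pi ^ 2 * ‖1 - polarPoint ρ s‖ ^ 2 := by
      rw [norm_one_sub_polarPoint_sq]
      gcongr
      nlinarith [sq_nonneg (1 - ρ), sq_nonneg (Real.sin (s / 2))]
    _ = _ := by ring

/-- Differentiating costs a factor of at most `2 / |1 - z|`, which `|s|` compensates. Hence `P_1`
acts on functions that are `O(s)` with mass bounded uniformly in `ρ`. -/
lemma abs_poissonDeriv_one_mul_le {ρ s : ℝ} (hρ : 1 / 2 ≤ ρ) (hρ' : ρ < 1)
    (hs : |s| ≤ Real.pi) :
    |poissonDeriv 1 ρ s| * |s| ≤ 2 * Real.pi * poissonDeriv 0 ρ s := by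
  have hρa : |ρ| < 1 := by rw [abs_lt]; constructor <;> linarith
  have hne := polarPoint_ne_one hρa s
  have hpos : 0 < ‖1 - polarPoint ρ s‖ := norm_pos_iff.2 (sub_ne_zero.2 hne.symm)
  have h0 := poissonDeriv_zero_nonneg hρa s
  have hH : |(schwarzKernel (polarPoint ρ s)).im| ≤ 2 / ‖1 - polarPoint ρ s‖ := by
    refine (Complex.abs_im_le_norm _).trans ?_
    rw [schwarzKernel, norm_div]
    gcongr
    refine (norm_add_le _ _).trans ?_
    rw [norm_one, norm_polarPoint]
    linarith
  calc |poissonDeriv 1 ρ s| * |s|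
      = poissonDeriv 0 ρ s * |(schwarzKernel (polarPoint ρ s)).im| * |s| := by
        rw [poissonDeriv_one hne, abs_mul, abs_neg, abs_of_nonneg h0]
    _ ≤ poissonDeriv 0 ρ s * (2 / ‖1 - polarPoint ρ s‖)
        * (Real.pi * ‖1 - polarPoint ρ s‖) := by
        gcongr
        exact abs_le_mul_norm_one_sub_polarPoint hρ hs
    _ = _ := by field_simp

lemma periodic_polarPoint (ρ : ℝ) : Function.Periodic (polarPoint ρ) (2 * Real.pi) := by
  intro s
  have := Complex.exp_periodic (s * Complex.I)
  simp only [polarPoint]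
  rw [← this]
  push_cast
  ring_nf

lemma periodic_poissonDeriv (n : ℕ) (ρ : ℝ) :
    Function.Periodic (poissonDeriv n ρ) (2 * Real.pi) := fun s => by
  simp only [poissonDeriv, periodic_polarPoint ρ s]

/-- Mean value property of the real part of the Schwarz kernel, which equals `1` at the origin. -/
lemma integral_poissonDeriv_zero {ρ : ℝ} (hρ : |ρ| < 1) :
    ∫ s in (0 : ℝ)..2 * Real.pi, poissonDeriv 0 ρ s = 2 * Real.pi := by
  have h : InnerProductSpace.HarmonicOnNhd (fun z => (schwarzKernel z).re)
      (Metric.closedBall 0 |ρ|) := fun z hz => by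
    refine (analyticOnNhd_schwarzKernel z ?_).harmonicAt_re
    rintro rfl
    simp at hz
    linarith
  have h1 := h.circleAverage_eq
  have h2 : ∀ s, (fun z => (schwarzKernel z).re) (circleMap 0 ρ s) = poissonDeriv 0 ρ s := fun s => by
    simp [circleMap, poissonDeriv, polarPoint]
  rw [Real.circleAverage_def] at h1
  simp only [h2, smul_eq_mul] at h1
  have h3 : (schwarzKernel 0).re = 1 := by simp [schwarzKernel]
  rw [h3] at h1
  have := Real.pi_pos
  field_simp at h1
  linarith

/-! ### Integral representation of the inner analytic function -/

/-- The `n`-th angular derivative of the Schwarz integral of `F`, up to the factor `1 / (2π)`. -/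
def schwarzIntegral (F : ℝ → ℝ) (n : ℕ) (z : ℂ) : ℂ :=
  ∫ φ in (-Real.pi)..Real.pi,
    angularDeriv^[n] schwarzKernel (z * Complex.exp (-φ * Complex.I)) * F φ

lemma intervalIntegrable_ofReal {F : ℝ → ℝ} {a b : ℝ} (hF : IntervalIntegrable F volume a b) :
    IntervalIntegrable (fun x => (F x : ℂ)) volume a b :=
  ⟨hF.1.ofReal, hF.2.ofReal⟩

lemma norm_exp_neg_mul_I (φ : ℝ) : ‖Complex.exp (-φ * Complex.I)‖ = 1 := by
  simpa using Complex.norm_exp_ofReal_mul_I (-φ)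

lemma hasSum_schwarzKernel {z : ℂ} (hz : ‖z‖ < 1) :
    HasSum (fun k : ℕ => if k = 0 then 1 else 2 * z ^ k) (schwarzKernel z) := by
  have h1 := (hasSum_geometric_of_norm_lt_one hz).mul_left 2
  have h2 := h1.sub (hasSum_ite_eq (0 : ℕ) (1 : ℂ))
  have hne : (1 : ℂ) - z ≠ 0 := sub_ne_zero.2 fun h => by rw [← h] at hz; simp at hz
  have e : 2 * (1 - z)⁻¹ - 1 = schwarzKernel z := by
    rw [schwarzKernel]
    field_simp
    ring
  rw [← e]
  refine h2.congr_fun fun k => ?_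
  split_ifs with h
  · subst h; norm_num
  · ring

lemma two_pi_mul_taylorCoeff {F : ℝ → ℝ}
    (hF : IntervalIntegrable F volume (-Real.pi) Real.pi) (k : ℕ) :
    2 * Real.pi * taylorCoeff F k = ∫ φ in (-Real.pi)..Real.pi,
      (if k = 0 then 1 else 2 * Complex.exp (-φ * Complex.I) ^ k) * (F φ : ℂ) := by
  have hpi : (Real.pi : ℂ) ≠ 0 := by exact_mod_cast Real.pi_ne_zero
  rw [taylorCoeff]
  split_ifs with h
  · simp only [fourierCos, Nat.cast_zero, zero_mul, Real.cos_zero, one_mul,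
      intervalIntegral.integral_ofReal]
    push_cast
    field_simp
  · have e : ∀ φ : ℝ, 2 * Complex.exp (-φ * Complex.I) ^ k * (F φ : ℂ)
        = 2 * ((Real.cos (k * φ) * F φ : ℝ) : ℂ)
          - 2 * Complex.I * ((Real.sin (k * φ) * F φ : ℝ) : ℂ) := fun φ => by
      rw [← Complex.exp_nat_mul, show (k : ℂ) * (-φ * Complex.I) = (-(k * φ)) * Complex.I by ring,
        Complex.exp_mul_I, Complex.cos_neg, Complex.sin_neg]
      push_cast
      ring
    have hc : IntervalIntegrable (fun φ => ((Real.cos (k * φ) * F φ : ℝ) : ℂ)) volume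
        (-Real.pi) Real.pi := 
      intervalIntegrable_ofReal (hF.continuousOn_mul (by fun_prop))
    have hs : IntervalIntegrable (fun φ => ((Real.sin (k * φ) * F φ : ℝ) : ℂ)) volume
        (-Real.pi) Real.pi := 
      intervalIntegrable_ofReal (hF.continuousOn_mul (by fun_prop))
    simp_rw [e]
    rw [intervalIntegral.integral_sub (hc.const_mul _) (hs.const_mul _),
      intervalIntegral.integral_const_mul, intervalIntegral.integral_const_mul,
      intervalIntegral.integral_ofReal, intervalIntegral.integral_ofReal, fourierCos, fourierSin]
    push_cast
    field_simp

/-- The series of the Schwarz kernel at `z e^{-iφ}` is integrated against `F` term by term,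
dominated by the geometric series `2 ‖z‖ ^ k |F φ|`. -/
lemma hasSum_innerAnalytic {F : ℝ → ℝ}
    (hF : IntervalIntegrable F volume (-Real.pi) Real.pi) {z : ℂ} (hz : ‖z‖ < 1) :
    HasSum (fun k => 2 * Real.pi * taylorCoeff F k * z ^ k) (schwarzIntegral F 0 z) := by
  have e : ∀ k, 2 * Real.pi * taylorCoeff F k * z ^ k = ∫ φ in (-Real.pi)..Real.pi,
      (if k = 0 then 1 else 2 * (z * Complex.exp (-φ * Complex.I)) ^ k) * (F φ : ℂ) := fun k => by
    rw [two_pi_mul_taylorCoeff hF, ← intervalIntegral.integral_mul_const]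
    congr 1
    funext φ
    split_ifs with h
    · simp [h]
    · ring
  simp_rw [e]
  have hn : ∀ φ : ℝ, ‖z * Complex.exp (-φ * Complex.I)‖ = ‖z‖ := fun φ => by
    rw [norm_mul, norm_exp_neg_mul_I, mul_one]
  have hs : Summable fun k : ℕ => 2 * ‖z‖ ^ k :=
    (summable_geometric_of_lt_one (norm_nonneg z) hz).mul_left 2
  refine intervalIntegral.hasSum_integral_of_dominated_convergence
    (fun k φ => 2 * ‖z‖ ^ k * |F φ|) (fun k => ?_) (fun k => ?_) ?_ ?_ ?_
  · have h1 : Continuous fun φ : ℝ =>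
        if k = 0 then (1 : ℂ) else 2 * (z * Complex.exp (-φ * Complex.I)) ^ k := by
      split_ifs <;> fun_prop
    exact h1.aestronglyMeasurable.mul (intervalIntegrable_ofReal hF).def'.aestronglyMeasurable
  · refine Eventually.of_forall fun φ _ => ?_
    rw [norm_mul, Complex.norm_real, Real.norm_eq_abs]
    gcongr
    split_ifs with h
    · simp [h]
    · rw [norm_mul, norm_pow, hn, Complex.norm_ofNat]
  · exact Eventually.of_forall fun φ _ => hs.mul_right _
  · simp_rw [tsum_mul_right]
    exact hF.abs.const_mul _
  · refine Eventually.of_forall fun φ _ => ?_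
    exact (hasSum_schwarzKernel (by rwa [hn])).mul_right _

lemma hasDerivAt_schwarzIntegral {F : ℝ → ℝ}
    (hF : IntervalIntegrable F volume (-Real.pi) Real.pi) (n : ℕ) {z : ℂ} (hz : ‖z‖ < 1) :
    HasDerivAt (schwarzIntegral F n) (∫ φ in (-Real.pi)..Real.pi,
      deriv (angularDeriv^[n] schwarzKernel) (z * Complex.exp (-φ * Complex.I))
        * Complex.exp (-φ * Complex.I) * F φ) z := by
  -- Rotations preserve the closed disk of radius `r < 1`, so one bound on the kernel's derivative
  -- there serves all `φ` and dominates the differentiation under the integral.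
  obtain ⟨r, hzr, hr1⟩ := exists_between hz
  have hne : ∀ y : ℂ, ‖y‖ < 1 → y ≠ 1 := fun y hy h => by rw [h, norm_one] at hy; linarith
  have hn : ∀ (y : ℂ) (φ : ℝ), ‖y * Complex.exp (-φ * Complex.I)‖ = ‖y‖ := fun y φ => by
    rw [norm_mul, norm_exp_neg_mul_I, mul_one]
  have hA := analyticOnNhd_iterate_angularDeriv analyticOnNhd_schwarzKernel n
  obtain ⟨M, hM⟩ := (isCompact_closedBall (0 : ℂ) r).exists_bound_of_continuousOn
    (f := deriv (angularDeriv^[n] schwarzKernel))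
    (hA.deriv.continuousOn.mono fun y hy => hne y (by simp at hy; linarith))
  have hcont : ∀ g : ℂ → ℂ, ContinuousOn g {1}ᶜ → ∀ y : ℂ, ‖y‖ < 1 →
      Continuous fun φ : ℝ => g (y * Complex.exp (-φ * Complex.I)) := fun g hg y hy =>
    hg.comp_continuous (by fun_prop) fun φ => hne _ (by rwa [hn])
  have hball : ∀ y ∈ Metric.ball (0 : ℂ) r, ‖y‖ < 1 := fun y hy => by
    simp at hy; linarith
  have hs : Metric.ball (0 : ℂ) r ∈ 𝓝 z := Metric.isOpen_ball.mem_nhds (by simpa using hzr)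
  refine (intervalIntegral.hasDerivAt_integral_of_dominated_loc_of_deriv_le
    (F' := fun y φ => deriv (angularDeriv^[n] schwarzKernel) (y * Complex.exp (-φ * Complex.I))
        * Complex.exp (-φ * Complex.I) * F φ) (bound := fun φ => M * |F φ|) hs ?_ ?_ ?_ ?_ ?_ ?_).2
  · filter_upwards [hs] with y hy
    exact (hcont _ hA.continuousOn y (hball y hy)).aestronglyMeasurable.mul
      (intervalIntegrable_ofReal hF).def'.aestronglyMeasurable
  · exact (intervalIntegrable_ofReal hF).continuousOn_mul (hcont _ hA.continuousOn z hz).continuousOn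
  · exact ((hcont _ hA.deriv.continuousOn z hz).mul
      (by fun_prop)).aestronglyMeasurable.mul (intervalIntegrable_ofReal hF).def'.aestronglyMeasurable
  · refine Eventually.of_forall fun φ _ y hy => ?_
    rw [norm_mul, norm_mul, norm_exp_neg_mul_I, mul_one, Complex.norm_real, Real.norm_eq_abs]
    gcongr
    exact hM _ (by rw [mem_closedBall_zero_iff, hn]; exact (mem_ball_zero_iff.1 hy).le)
  · exact hF.abs.const_mul M
  · refine Eventually.of_forall fun φ _ y hy => ?_
    have h1 : HasDerivAt (fun y : ℂ => y * Complex.exp (-φ * Complex.I))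
        (Complex.exp (-φ * Complex.I)) y := by
      simpa using (hasDerivAt_id y).mul_const (Complex.exp (-φ * Complex.I))
    have h2 := (hA (y * Complex.exp (-φ * Complex.I))
      (hne _ (by rw [hn]; exact hball y hy))).differentiableAt.hasDerivAt
    exact (h2.comp y h1).mul_const _

/-- `angularDeriv` commutes with rotations: the chain rule factor `e^{-iφ}` joins `z` to form the
rotated argument. -/
lemma angularDeriv_schwarzIntegral {F : ℝ → ℝ}
    (hF : IntervalIntegrable F volume (-Real.pi) Real.pi) (n : ℕ) {z : ℂ} (hz : ‖z‖ < 1) :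
    angularDeriv (schwarzIntegral F n) z = schwarzIntegral F (n + 1) z := by
  rw [angularDeriv, (hasDerivAt_schwarzIntegral hF n hz).deriv, schwarzIntegral,
    ← intervalIntegral.integral_const_mul]
  congr 1
  funext φ
  rw [Function.iterate_succ_apply', angularDeriv]
  ring

lemma iterate_angularDeriv_innerAnalytic {F : ℝ → ℝ}
    (hF : IntervalIntegrable F volume (-Real.pi) Real.pi) (n : ℕ) {z : ℂ} (hz : ‖z‖ < 1) :
    2 * Real.pi * angularDeriv^[n] (innerAnalyticOfIntegrable F) z = schwarzIntegral F n z := by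
  have hpi : (2 * Real.pi : ℂ) ≠ 0 := by exact_mod_cast Real.two_pi_pos.ne'
  induction n generalizing z with
  | zero =>
    rw [← (hasSum_innerAnalytic hF hz).tsum_eq, Function.iterate_zero, id,
      innerAnalyticOfIntegrable, ← tsum_mul_left]
    simp_rw [mul_assoc]
  | succ n ih =>
    rw [← angularDeriv_schwarzIntegral hF n hz, Function.iterate_succ_apply', angularDeriv,
      angularDeriv]
    have : schwarzIntegral F n =ᶠ[𝓝 z]
        fun z => 2 * Real.pi * angularDeriv^[n] (innerAnalyticOfIntegrable F) z := by
      filter_upwards [Metric.isOpen_ball.mem_nhds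
        (show z ∈ Metric.ball (0 : ℂ) 1 by simpa using hz)] with y hy
      exact (ih (by simpa using hy)).symm
    rw [this.deriv_eq, deriv_const_mul_field]
    ring

lemma analyticOnNhd_innerAnalytic {F : ℝ → ℝ}
    (hF : IntervalIntegrable F volume (-Real.pi) Real.pi) :
    AnalyticOnNhd ℂ (innerAnalyticOfIntegrable F) (Metric.ball 0 1) := by
  have hpi : (2 * Real.pi : ℂ) ≠ 0 := by exact_mod_cast Real.two_pi_pos.ne'
  refine DifferentiableOn.analyticOnNhd (fun z hz => ?_) Metric.isOpen_ball
  have hd := ((hasDerivAt_schwarzIntegral hF 0 (by simpa using hz)).const_mul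
    (2 * Real.pi : ℂ)⁻¹).differentiableAt
  refine (hd.congr_of_eventuallyEq ?_).differentiableWithinAt
  filter_upwards [Metric.isOpen_ball.mem_nhds hz] with y hy
  have := iterate_angularDeriv_innerAnalytic hF 0 (z := y) (by simpa using hy)
  rw [← this, Function.iterate_zero, id, inv_mul_cancel_left₀ hpi]

lemma re_iterate_angularDeriv_innerAnalytic {F : ℝ → ℝ}
    (hF : IntervalIntegrable F volume (-Real.pi) Real.pi) (n : ℕ) {ρ : ℝ} (hρ : |ρ| < 1)
    (θ : ℝ) :
    2 * Real.pi * (angularDeriv^[n] (innerAnalyticOfIntegrable F) (polarPoint ρ θ)).re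
      = ∫ φ in (-Real.pi)..Real.pi, poissonDeriv n ρ (θ - φ) * F φ := by
  have h := iterate_angularDeriv_innerAnalytic hF n (z := polarPoint ρ θ)
    (by rwa [norm_polarPoint])
  have e : ∀ φ : ℝ, polarPoint ρ θ * Complex.exp (-φ * Complex.I) = polarPoint ρ (θ - φ) :=
    fun φ => by
      rw [polarPoint, polarPoint, mul_assoc, ← Complex.exp_add]
      push_cast
      ring_nf
  have hre := congrArg Complex.re h
  rw [show (2 * Real.pi : ℂ) = ((2 * Real.pi : ℝ) : ℂ) by push_cast; rfl,
    Complex.re_ofReal_mul] at hre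
  rw [hre, schwarzIntegral]
  simp_rw [e]
  have hc : Continuous fun φ : ℝ => angularDeriv^[n] schwarzKernel (polarPoint ρ (θ - φ)) := by
    refine continuous_iff_continuousAt.2 fun φ => ?_
    refine ContinuousAt.comp (f := fun φ => polarPoint ρ (θ - φ))
      (analyticAt_iterate_schwarzKernel n (polarPoint_ne_one hρ _)).continuousAt ?_
    unfold polarPoint
    fun_prop
  have := Complex.reCLM.intervalIntegral_comp_comm ((intervalIntegrable_ofReal hF).continuousOn_mul hc.continuousOn)
  rw [Complex.reCLM_apply] at this
  rw [← this]
  congr 1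
  funext φ
  simp [poissonDeriv]

/-! ### Localization and integration by parts -/

lemma eventually_abs_lt_one_nhdsLT : ∀ᶠ ρ : ℝ in 𝓝[<] 1, 1 / 2 ≤ ρ ∧ ρ < 1 ∧ |ρ| < 1 := by
  filter_upwards [Ioo_mem_nhdsLT (show (1 / 2 : ℝ) < 1 by norm_num)] with ρ hρ
  exact ⟨hρ.1.le, hρ.2, abs_lt.2 ⟨by linarith [hρ.1], hρ.2⟩⟩

lemma tendsto_poissonDeriv (n : ℕ) {s : ℝ} (h : polarPoint 1 s ≠ 1) :
    Tendsto (fun ρ => poissonDeriv n ρ s) (𝓝[<] 1) (𝓝 0) := by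
  have h1 := continuousAt_poissonDeriv n (p := ((1 : ℝ), s)) h
  have h2 : ContinuousAt (fun ρ : ℝ => poissonDeriv n ρ s) 1 :=
    ContinuousAt.comp (f := fun ρ : ℝ => (ρ, s)) (g := fun p : ℝ × ℝ => poissonDeriv n p.1 p.2)
      h1 (by fun_prop)
  have h3 := h2.tendsto
  rw [poissonDeriv_one_left n h] at h3
  exact h3.mono_left nhdsWithin_le_nhds

lemma polarPoint_one_ne_one {s : ℝ} (h0 : 0 < |s|) (h1 : |s| < 2 * Real.pi) :
    polarPoint 1 s ≠ 1 := by
  intro h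
  have h2 := norm_one_sub_polarPoint_sq 1 s
  rw [h] at h2
  have h3 : Real.sin (s / 2) = 0 := by
    have : Real.sin (s / 2) ^ 2 = 0 := by simp at h2; simp [h2]
    exact pow_eq_zero_iff two_ne_zero |>.1 this
  have h4 := abs_lt.1 h1
  rw [Real.sin_eq_zero_iff_of_lt_of_lt (by linarith) (by linarith)] at h3
  rw [abs_pos] at h0
  exact h0 (by linarith)

/-- The contribution of the arcs away from the direction `θ` disappears in the limit. -/
lemma tendsto_integral_poissonDeriv_away (n : ℕ) {F : ℝ → ℝ} {a b θ : ℝ}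
    (hF : IntervalIntegrable F volume a b)
    (h : ∀ φ ∈ Set.uIcc a b, polarPoint 1 (θ - φ) ≠ 1) :
    Tendsto (fun ρ => ∫ φ in a..b, poissonDeriv n ρ (θ - φ) * F φ) (𝓝[<] 1) (𝓝 0) := by
  -- The rectangle is closed at `ρ = 1`, where the kernel is still continuous because `φ` avoids the
  -- direction `θ`. Compactness gives a bound uniform in `ρ`, as dominated convergence requires.
  have hcomp : IsCompact (Set.Icc (1 / 2 : ℝ) 1 ×ˢ Set.uIcc a b) := isCompact_Icc.prod isCompact_uIcc
  have hcont : ContinuousOn (fun p : ℝ × ℝ => poissonDeriv n p.1 (θ - p.2))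
      (Set.Icc (1 / 2 : ℝ) 1 ×ˢ Set.uIcc a b) := by
    rintro ⟨ρ, φ⟩ ⟨hρ, hφ⟩
    refine ContinuousAt.continuousWithinAt ?_
    refine ContinuousAt.comp (f := fun p : ℝ × ℝ => (p.1, θ - p.2))
      (g := fun p : ℝ × ℝ => poissonDeriv n p.1 p.2) (continuousAt_poissonDeriv n ?_) (by fun_prop)
    rcases hρ.2.lt_or_eq with h1 | h1
    · exact polarPoint_ne_one (abs_lt.2 ⟨by linarith [hρ.1], h1⟩) _
    · simp only at h1
      simp only [h1]
      exact h φ hφ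
  obtain ⟨M, hM⟩ := hcomp.exists_bound_of_continuousOn hcont
  have h0 : (0 : ℝ) = ∫ φ in a..b, (0 : ℝ) := by simp
  rw [h0]
  refine intervalIntegral.tendsto_integral_filter_of_dominated_convergence
    (fun φ => M * |F φ|) ?_ ?_ (hF.abs.const_mul M) ?_
  · filter_upwards [eventually_abs_lt_one_nhdsLT] with ρ hρ
    exact ((continuous_poissonDeriv n hρ.2.2).comp
      (by fun_prop)).aestronglyMeasurable.mul hF.def'.aestronglyMeasurable
  · filter_upwards [eventually_abs_lt_one_nhdsLT] with ρ hρ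
    refine Eventually.of_forall fun φ hφ => ?_
    rw [norm_mul, Real.norm_eq_abs (F φ)]
    gcongr
    exact hM (ρ, φ) ⟨⟨hρ.1, hρ.2.1.le⟩, Set.uIoc_subset_uIcc hφ⟩
  · refine Eventually.of_forall fun φ hφ => ?_
    simpa using (tendsto_poissonDeriv n (h φ (Set.uIoc_subset_uIcc hφ))).mul_const (F φ)

/-- Integration by parts against a function given by its integral. -/
lemma integral_mul_eq_sub_of_eq_integral {k k' g G : ℝ → ℝ} {a b : ℝ} (hab : a ≤ b)
    (hk : ∀ x, HasDerivAt k (k' x) x) (hk' : Continuous k')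
    (hg : IntervalIntegrable g volume a b)
    (hG : ∀ x ∈ Set.Icc a b, G x - G a = ∫ t in a..x, g t) :
    ∫ x in a..b, k' x * G x = k b * G b - k a * G a - ∫ x in a..b, k x * g x := by
  have hkd : deriv k = k' := funext fun x => (hk x).deriv
  have hkc : ContDiff ℝ 1 k := by
    rw [contDiff_one_iff_deriv, hkd]
    exact ⟨fun x => (hk x).differentiableAt, hk'⟩
  have hkac : AbsolutelyContinuousOnInterval k a b :=
    hkc.contDiffOn.absolutelyContinuousOnInterval
  have hgac := hg.absolutelyContinuousOnInterval_intervalIntegral (c := a) Set.left_mem_uIcc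
  -- As `g` is merely integrable, its primitive is differentiable only almost everywhere; absolute
  -- continuity is what justifies the integration by parts.
  have h1 := hkac.integral_mul_deriv_eq_deriv_mul hgac
  have h2 : ∫ x in a..b, k x * deriv (fun x => ∫ t in a..x, g t) x = ∫ x in a..b, k x * g x := by
    refine intervalIntegral.integral_congr_ae ?_
    filter_upwards [hg.ae_hasDerivAt_integral] with x hx hxm
    rw [(hx (Set.uIoc_subset_uIcc hxm) a Set.left_mem_uIcc).deriv]
  have h3 : ∫ x in a..b, k' x * G x
      = (∫ x in a..b, k' x * ∫ t in a..x, g t) + ∫ x in a..b, k' x * G a := by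
    rw [← intervalIntegral.integral_add]
    · refine intervalIntegral.integral_congr fun x hx => ?_
      rw [Set.uIcc_of_le hab] at hx
      simp only [← hG x hx]
      ring
    · exact (hgac.continuousOn.intervalIntegrable).continuousOn_mul hk'.continuousOn
    · exact (hk'.mul continuous_const).intervalIntegrable _ _
  have h4 : ∫ x in a..b, k' x = k b - k a :=
    intervalIntegral.integral_eq_sub_of_hasDerivAt (fun x _ => hk x) (hk'.intervalIntegrable _ _)
  have h5 := hG b (Set.right_mem_Icc.2 hab)
  rw [h2, hkd] at h1
  simp only [intervalIntegral.integral_same, mul_zero, sub_zero, ← h5] at h1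
  rw [intervalIntegral.integral_mul_const, h4] at h3
  linear_combination h3 + h1

lemma hasDerivAt_poissonDeriv_sub (n : ℕ) {ρ : ℝ} (hρ : |ρ| < 1) (θ φ : ℝ) :
    HasDerivAt (fun φ => poissonDeriv n ρ (θ - φ)) (-poissonDeriv (n + 1) ρ (θ - φ)) φ := by
  have h := (hasDerivAt_poissonDeriv n (polarPoint_ne_one hρ (θ - φ))).comp φ
    ((hasDerivAt_id φ).const_sub θ)
  exact h.congr_deriv (by ring)

lemma integral_poissonDeriv_succ (n : ℕ) {g G : ℝ → ℝ} {a b θ ρ : ℝ} (hab : a ≤ b)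
    (hρ : |ρ| < 1) (hg : IntervalIntegrable g volume a b)
    (hG : ∀ x ∈ Set.Icc a b, G x - G a = ∫ t in a..x, g t) :
    ∫ φ in a..b, poissonDeriv (n + 1) ρ (θ - φ) * G φ =
      (poissonDeriv n ρ (θ - a) * G a - poissonDeriv n ρ (θ - b) * G b)
        + ∫ φ in a..b, poissonDeriv n ρ (θ - φ) * g φ := by
  have h := integral_mul_eq_sub_of_eq_integral hab (hasDerivAt_poissonDeriv_sub n hρ θ)
    (((continuous_poissonDeriv (n + 1) hρ).comp (by fun_prop)).neg) hg hG
  simp only [neg_mul, intervalIntegral.integral_neg] at h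
  linarith

/-- Near a direction without singularities the piecewise integrations are undone by the angular
derivatives of the Poisson kernel, up to a quantity that disappears in the limit. -/
lemma tendsto_integral_poissonDeriv_of_primitive {S : Set ℝ} {g : ℝ → ℝ} {a b θ L : ℝ}
    (hab : a ≤ b) (hS : Disjoint (Set.Icc a b) S)
    (ha : polarPoint 1 (θ - a) ≠ 1) (hb : polarPoint 1 (θ - b) ≠ 1)
    (hL : Tendsto (fun ρ => ∫ φ in a..b, poissonDeriv 0 ρ (θ - φ) * g φ) (𝓝[<] 1) (𝓝 L))
    (n : ℕ) {F : ℝ → ℝ} (hF : IsIteratedPiecewisePrimitive S n F g) :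
    Tendsto (fun ρ => ∫ φ in a..b, poissonDeriv n ρ (θ - φ) * F φ) (𝓝[<] 1) (𝓝 L) := by
  induction n generalizing F with
  | zero => rwa [show F = g from hF]
  | succ n ih =>
    obtain ⟨H, hH, -, hFH⟩ := hF
    -- The boundary values of `F` do not depend on `ρ`, while the kernel at both endpoints tends to
    -- zero.
    have h1 := (((tendsto_poissonDeriv n ha).mul_const (F a)).sub
      ((tendsto_poissonDeriv n hb).mul_const (F b))).add (ih hH)
    rw [zero_mul, zero_mul, sub_zero, zero_add] at h1
    refine h1.congr' ?_
    filter_upwards [eventually_abs_lt_one_nhdsLT] with ρ hρ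
    refine (integral_poissonDeriv_succ n hab hρ.2.2 (hFH a b hab hS).1 fun x hx => ?_).symm
    exact (hFH a x hx.1 (hS.mono_left (Set.Icc_subset_Icc_right hx.2))).2

/-! ### Local Fatou theorem -/

lemma integral_poissonDeriv_zero_sub {ρ : ℝ} (hρ : |ρ| < 1) (θ : ℝ) :
    ∫ φ in (θ - Real.pi)..(θ + Real.pi), poissonDeriv 0 ρ (θ - φ) = 2 * Real.pi := by
  rw [intervalIntegral.integral_comp_sub_left (poissonDeriv 0 ρ) θ,
    ← integral_poissonDeriv_zero hρ]
  have := (periodic_poissonDeriv 0 ρ).intervalIntegral_add_eq (-Real.pi) 0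
  rw [zero_add] at this
  rw [← this]
  congr 1 <;> ring

lemma tendsto_integral_poissonDeriv_zero {θ δ : ℝ} (hδ : 0 < δ) (hδ' : δ ≤ Real.pi) :
    Tendsto (fun ρ => ∫ φ in (θ - δ)..(θ + δ), poissonDeriv 0 ρ (θ - φ)) (𝓝[<] 1)
      (𝓝 (2 * Real.pi)) := by
  have hpi := Real.pi_pos
  have away : ∀ a b, (∀ φ ∈ Set.uIcc a b, polarPoint 1 (θ - φ) ≠ 1) →
      Tendsto (fun ρ => ∫ φ in a..b, poissonDeriv 0 ρ (θ - φ)) (𝓝[<] 1) (𝓝 0) := fun a b h => by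
    simpa using tendsto_integral_poissonDeriv_away 0 (F := fun _ => 1) (by simp) h
  have h1 := away (θ - Real.pi) (θ - δ) fun φ hφ => by
    rw [Set.uIcc_of_le (by linarith)] at hφ
    have : 0 < θ - φ := by linarith [hφ.2]
    exact polarPoint_one_ne_one (abs_pos.2 this.ne') (by rw [abs_of_pos this]; linarith [hφ.1])
  have h2 := away (θ + δ) (θ + Real.pi) fun φ hφ => by
    rw [Set.uIcc_of_le (by linarith)] at hφ
    have : θ - φ < 0 := by linarith [hφ.1]
    exact polarPoint_one_ne_one (abs_pos.2 this.ne) (by rw [abs_of_neg this]; linarith [hφ.2])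
  have h3 := (tendsto_const_nhds (x := 2 * Real.pi)).sub (h1.add h2)
  rw [add_zero, sub_zero] at h3
  refine h3.congr' ?_
  filter_upwards [eventually_abs_lt_one_nhdsLT] with ρ hρ
  have hi : ∀ a b, IntervalIntegrable (fun φ => poissonDeriv 0 ρ (θ - φ)) volume a b := fun a b =>
    ((continuous_poissonDeriv 0 hρ.2.2).comp (by fun_prop)).intervalIntegrable a b
  rw [← integral_poissonDeriv_zero_sub hρ.2.2 θ,
    ← intervalIntegral.integral_add_adjacent_intervals (hi _ (θ - δ)) (hi (θ - δ) _),
    ← intervalIntegral.integral_add_adjacent_intervals (hi (θ - δ) (θ + δ)) (hi (θ + δ) _)]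
  ring

lemma integral_poissonDeriv_zero_le {ρ θ δ : ℝ} (hρ : |ρ| < 1) (hδ : 0 < δ) (hδ' : δ ≤ Real.pi) :
    ∫ φ in (θ - δ)..(θ + δ), poissonDeriv 0 ρ (θ - φ) ≤ 2 * Real.pi := by
  rw [← integral_poissonDeriv_zero_sub hρ θ]
  refine intervalIntegral.integral_mono_interval (by linarith) (by linarith) (by linarith)
    (Eventually.of_forall fun φ => poissonDeriv_zero_nonneg hρ _) ?_
  exact ((continuous_poissonDeriv 0 hρ).comp (by fun_prop)).intervalIntegrable _ _

/-- Integrals of `G` against the angular derivative of the Poisson kernel disappear in the limit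
if `G` vanishes to more than first order. -/
lemma tendsto_integral_poissonDeriv_one {G : ℝ → ℝ} {θ δ : ℝ} (hδ : 0 < δ) (hδ' : δ ≤ Real.pi)
    (hG : ContinuousOn G (Set.Icc (θ - δ) (θ + δ))) (hG' : G =o[𝓝 θ] fun φ => φ - θ) :
    Tendsto (fun ρ => ∫ φ in (θ - δ)..(θ + δ), poissonDeriv 1 ρ (θ - φ) * G φ)
      (𝓝[<] 1) (𝓝 0) := by
  have hpi := Real.pi_pos
  rw [Metric.tendsto_nhds]
  intro ε hε
  -- The factor `4π²` is `2π` from `abs_poissonDeriv_one_mul_le` times the bound `2π` on the mass of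
  -- the kernel. The remaining `ε / 2` is for the two outer arcs.
  obtain ⟨C, hC, hCε⟩ : ∃ C : ℝ, 0 < C ∧ C * (4 * Real.pi ^ 2) < ε / 2 :=
    ⟨ε / (16 * Real.pi ^ 2), by positivity, by field_simp; norm_num⟩
  obtain ⟨r, hr, hball⟩ := Metric.eventually_nhds_iff.1 (hG'.def hC)
  obtain ⟨η, hη, hηr, hηδ⟩ : ∃ η, 0 < η ∧ η < r ∧ η < δ :=
    ⟨min r δ / 2, by positivity, by have := min_le_left r δ; have := lt_min hr hδ; linarith,
      by have := min_le_right r δ; have := lt_min hr hδ; linarith⟩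
  have hint : ∀ a b, θ - δ ≤ a → a ≤ b → b ≤ θ + δ → IntervalIntegrable G volume a b :=
    fun a b h1 h2 h3 => ContinuousOn.intervalIntegrable_of_Icc h2
      (hG.mono (Set.Icc_subset_Icc h1 h3))
  have h1 := tendsto_integral_poissonDeriv_away 1 (θ := θ)
    (hint (θ - δ) (θ - η) le_rfl (by linarith) (by linarith)) fun φ hφ => by
      rw [Set.uIcc_of_le (by linarith)] at hφ
      have : 0 < θ - φ := by linarith [hφ.2]
      exact polarPoint_one_ne_one (abs_pos.2 this.ne') (by rw [abs_of_pos this]; linarith [hφ.1])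
  have h2 := tendsto_integral_poissonDeriv_away 1 (θ := θ)
    (hint (θ + η) (θ + δ) (by linarith) (by linarith) le_rfl) fun φ hφ => by
      rw [Set.uIcc_of_le (by linarith)] at hφ
      have : θ - φ < 0 := by linarith [hφ.1]
      exact polarPoint_one_ne_one (abs_pos.2 this.ne) (by rw [abs_of_neg this]; linarith [hφ.2])
  have h3 := h1.add h2
  rw [add_zero, Metric.tendsto_nhds] at h3
  filter_upwards [h3 (ε / 2) (by positivity), eventually_abs_lt_one_nhdsLT] with ρ hρε hρ
  have hc : ∀ n, Continuous fun φ => poissonDeriv n ρ (θ - φ) := fun n =>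
    (continuous_poissonDeriv n hρ.2.2).comp (by fun_prop)
  have hi : ∀ a b, θ - δ ≤ a → a ≤ b → b ≤ θ + δ →
      IntervalIntegrable (fun φ => poissonDeriv 1 ρ (θ - φ) * G φ) volume a b :=
    fun a b h1 h2 h3 => (hint a b h1 h2 h3).continuousOn_mul (hc 1).continuousOn
  have hin : |∫ φ in (θ - η)..(θ + η), poissonDeriv 1 ρ (θ - φ) * G φ| < ε / 2 := by
    have hle : |∫ φ in (θ - η)..(θ + η), poissonDeriv 1 ρ (θ - φ) * G φ|
        ≤ ∫ φ in (θ - η)..(θ + η), C * (2 * Real.pi) * poissonDeriv 0 ρ (θ - φ) := by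
      have hci := ((hc 0).const_mul (C * (2 * Real.pi))).intervalIntegrable (μ := volume)
        (θ - η) (θ + η)
      rw [← Real.norm_eq_abs]
      refine intervalIntegral.norm_integral_le_of_norm_le (by linarith)
        (Eventually.of_forall fun φ hφ => ?_) hci
      have habs : |θ - φ| ≤ η := abs_le.2 ⟨by linarith [hφ.2], by linarith [hφ.1]⟩
      have hGφ := hball (y := φ) (by rw [Real.dist_eq, abs_sub_comm]; linarith)
      rw [Real.norm_eq_abs, Real.norm_eq_abs, abs_sub_comm] at hGφ
      rw [norm_mul, Real.norm_eq_abs, Real.norm_eq_abs]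
      calc _ ≤ |poissonDeriv 1 ρ (θ - φ)| * (C * |θ - φ|) := by gcongr
        _ = C * (|poissonDeriv 1 ρ (θ - φ)| * |θ - φ|) := by ring
        _ ≤ C * (2 * Real.pi * poissonDeriv 0 ρ (θ - φ)) :=
          mul_le_mul_of_nonneg_left
            (abs_poissonDeriv_one_mul_le hρ.1 hρ.2.1 (by linarith)) hC.le
        _ = _ := by ring
    refine hle.trans_lt (lt_of_le_of_lt ?_ hCε)
    rw [intervalIntegral.integral_const_mul]
    calc _ ≤ C * (2 * Real.pi) * (2 * Real.pi) := by
          gcongr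
          exact integral_poissonDeriv_zero_le hρ.2.2 hη (by linarith)
      _ = _ := by ring
  rw [Real.dist_eq, sub_zero] at hρε ⊢
  rw [← intervalIntegral.integral_add_adjacent_intervals
      (hi (θ - δ) (θ - η) le_rfl (by linarith) (by linarith))
      (hi (θ - η) (θ + δ) (by linarith) (by linarith) le_rfl),
    ← intervalIntegral.integral_add_adjacent_intervals
      (hi (θ - η) (θ + η) (by linarith) (by linarith) (by linarith))
      (hi (θ + η) (θ + δ) (by linarith) (by linarith) le_rfl)]
  rw [abs_lt] at *
  constructor <;> linarith [hρε.1, hρε.2, hin.1, hin.2]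

/-- A local form of Fatou's theorem on radial limits of Poisson integrals. -/
lemma tendsto_integral_poissonDeriv_zero_mul {g : ℝ → ℝ} {θ δ : ℝ} (hδ : 0 < δ)
    (hδ' : δ ≤ Real.pi) (hg : IntervalIntegrable g volume (θ - δ) (θ + δ))
    (hd : HasDerivAt (fun x => ∫ t in θ..x, g t) (g θ) θ) :
    Tendsto (fun ρ => ∫ φ in (θ - δ)..(θ + δ), poissonDeriv 0 ρ (θ - φ) * g φ)
      (𝓝[<] 1) (𝓝 (2 * Real.pi * g θ)) := by
  have hpi := Real.pi_pos
  have hsub : ∀ x ∈ Set.Icc (θ - δ) (θ + δ), ∀ y ∈ Set.Icc (θ - δ) (θ + δ),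
      IntervalIntegrable g volume x y := fun x hx y hy => hg.mono_set (by
    rw [Set.uIcc_of_le (by linarith : θ - δ ≤ θ + δ)]
    exact Set.uIcc_subset_Icc hx hy)
  have hθ : θ ∈ Set.Icc (θ - δ) (θ + δ) := ⟨by linarith, by linarith⟩
  have hl : θ - δ ∈ Set.Icc (θ - δ) (θ + δ) := ⟨by linarith, by linarith⟩
  -- A primitive of `g - g θ` vanishing at `θ`; by `hd` it is `o(x - θ)`. Integration by parts
  -- trades `P_0` against `g - g θ` for `P_1` against `G`, which tends to zero, and the constant `g
  -- θ` contributes `2π g θ`.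
  set G : ℝ → ℝ := fun x => (∫ t in θ..x, g t) - g θ * (x - θ) with hGdef
  have hGint : ∀ x ∈ Set.Icc (θ - δ) (θ + δ),
      G x - G (θ - δ) = ∫ t in (θ - δ)..x, (g t - g θ) := fun x hx => by
    rw [intervalIntegral.integral_sub (hsub _ hl _ hx) intervalIntegrable_const,
      intervalIntegral.integral_const, smul_eq_mul,
      ← intervalIntegral.integral_interval_sub_left (hsub _ hθ _ hx) (hsub _ hθ _ hl)]
    simp only [hGdef]
    ring
  have hGo : G =o[𝓝 θ] fun φ => φ - θ := by
    have := hasDerivAt_iff_isLittleO.1 hd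
    refine this.congr_left fun x => ?_
    simp [hGdef, mul_comm]
  have hGc : ContinuousOn G (Set.Icc (θ - δ) (θ + δ)) := by
    refine ContinuousOn.sub ?_ (by fun_prop)
    have := intervalIntegral.continuousOn_primitive_interval' hg (a := θ)
      (by rwa [Set.uIcc_of_le (by linarith)])
    rwa [Set.uIcc_of_le (by linarith)] at this
  have hne : ∀ s : ℝ, |s| = δ → polarPoint 1 s ≠ 1 := fun s hs =>
    polarPoint_one_ne_one (by rw [hs]; exact hδ) (by rw [hs]; linarith)
  have ha := hne (θ - (θ - δ)) (by rw [sub_sub_cancel, abs_of_pos hδ])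
  have hb := hne (θ - (θ + δ)) (by rw [sub_add_cancel_left, abs_neg, abs_of_pos hδ])
  have h1 := (tendsto_integral_poissonDeriv_one hδ hδ' hGc hGo).sub
    (((tendsto_poissonDeriv 0 ha).mul_const (G (θ - δ))).sub
      ((tendsto_poissonDeriv 0 hb).mul_const (G (θ + δ))))
  have h2 := h1.add ((tendsto_integral_poissonDeriv_zero (θ := θ) hδ hδ').mul_const (g θ))
  simp only [zero_mul, sub_zero, zero_add] at h2
  refine h2.congr' ?_
  filter_upwards [eventually_abs_lt_one_nhdsLT] with ρ hρ
  have hc : Continuous fun φ => poissonDeriv 0 ρ (θ - φ) :=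
    (continuous_poissonDeriv 0 hρ.2.2).comp (by fun_prop)
  have h3 := integral_poissonDeriv_succ 0 (θ := θ) (by linarith) hρ.2.2
    (hg.sub intervalIntegrable_const) hGint
  have h4 : ∫ φ in (θ - δ)..(θ + δ), poissonDeriv 0 ρ (θ - φ) * (g φ - g θ)
      = (∫ φ in (θ - δ)..(θ + δ), poissonDeriv 0 ρ (θ - φ) * g φ)
        - (∫ φ in (θ - δ)..(θ + δ), poissonDeriv 0 ρ (θ - φ)) * g θ := by
    rw [← intervalIntegral.integral_mul_const, ← intervalIntegral.integral_sub
      (hg.continuousOn_mul hc.continuousOn) ((hc.mul_const (g θ)).intervalIntegrable _ _)]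
    simp_rw [mul_sub]
  simp only [zero_add] at h3
  rw [h3, h4]
  ring

/-! ### Almost every direction is regular -/

lemma isClosed_nonintegrableSet (f : ℝ → ℝ) : IsClosed (nonintegrableSet f) := by
  rw [← isOpen_compl_iff, isOpen_iff_mem_nhds]
  intro x hx
  simp only [nonintegrableSet, Set.mem_compl_iff, Set.mem_ofPred_eq, not_not] at hx
  obtain ⟨s, hs, hfs⟩ := hx
  filter_upwards [eventually_mem_nhds_iff.2 hs] with y hy
  simpa [nonintegrableSet] using ⟨s, hy, hfs⟩

lemma mem_nonintegrableSet_add {f : ℝ → ℝ} (hper : Function.Periodic f (2 * Real.pi)) {x : ℝ}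
    (k : ℤ) (hx : x ∈ nonintegrableSet f) : x + k * (2 * Real.pi) ∈ nonintegrableSet f := by
  rintro ⟨s, hs, hfs⟩
  refine hx ⟨(fun y => y + k * (2 * Real.pi)) ⁻¹' s,
    (continuous_add_const _).continuousAt.preimage_mem_nhds hs, ?_⟩
  have hmp := measurePreserving_add_right (volume : Measure ℝ) (k * (2 * Real.pi))
  have := (hmp.integrableOn_comp_preimage
    (Homeomorph.addRight (k * (2 * Real.pi) : ℝ)).measurableEmbedding (s := s)).2 hfs
  refine this.congr (Eventually.of_forall fun y => ?_)
  exact (hper.int_mul k) y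

/-- By periodicity the set is covered by the countably many translates of its finite part in one
period. -/
lemma volume_nonintegrableSet {f : ℝ → ℝ} (hper : Function.Periodic f (2 * Real.pi))
    (hfin : (nonintegrableSet f ∩ Set.Ico 0 (2 * Real.pi)).Finite) :
    volume (nonintegrableSet f) = 0 := by
  have hc : (⋃ k : ℤ, (fun y => y + k * (2 * Real.pi)) ''
      (nonintegrableSet f ∩ Set.Ico 0 (2 * Real.pi))).Countable :=
    Set.countable_iUnion fun k => (hfin.image _).countable
  refine measure_mono_null (fun x hx => ?_) (hc.measure_zero volume)
  obtain ⟨k, hk, -⟩ := existsUnique_sub_zsmul_mem_Ico Real.two_pi_pos x 0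
  rw [zero_add, zsmul_eq_mul] at hk
  refine Set.mem_iUnion.2 ⟨k, x - k * (2 * Real.pi), ⟨?_, hk⟩, by ring⟩
  have := mem_nonintegrableSet_add hper (-k) hx
  push_cast at this
  rwa [neg_mul, ← sub_eq_add_neg] at this

/-- Almost every direction has a neighbourhood on which `f` is integrable, and is a point at which
the derivative of the integral of `f` is the value of `f`. -/
lemma ae_exists_hasDerivAt_integral {f : ℝ → ℝ} (hper : Function.Periodic f (2 * Real.pi))
    (hloc : LocallyIntegrableAE f) :
    ∀ᵐ θ : ℝ, ∃ δ, 0 < δ ∧ δ < Real.pi ∧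
      Disjoint (Set.Icc (θ - δ) (θ + δ)) (nonintegrableSet f) ∧
      IntervalIntegrable f volume (θ - δ) (θ + δ) ∧
      HasDerivAt (fun x => ∫ t in θ..x, f t) (f θ) θ := by
  have h1 : ∀ᵐ θ : ℝ, θ ∉ nonintegrableSet f :=
    measure_eq_zero_iff_ae_notMem.1 (volume_nonintegrableSet hper hloc.1)
  -- Lebesgue differentiation is available on each fixed interval where `f` is integrable. Rational
  -- endpoints leave countably many null sets to discard, and still provide an interval around each
  -- regular `θ`.
  have h2 : ∀ᵐ θ : ℝ, ∀ p q : ℚ, IntervalIntegrable f volume p q → θ ∈ Set.uIcc (p : ℝ) q →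
      ∀ c ∈ Set.uIcc (p : ℝ) q, HasDerivAt (fun x => ∫ t in c..x, f t) (f θ) θ := by
    simp only [ae_all_iff]
    exact fun p q h => h.ae_hasDerivAt_integral
  filter_upwards [h1, h2] with θ hθ hθ2
  obtain ⟨r, hr, hball⟩ := Metric.isOpen_iff.1 (isClosed_nonintegrableSet f).isOpen_compl θ hθ
  have hdisj : ∀ a b, θ - r < a → b < θ + r →
      Disjoint (Set.Icc a b) (nonintegrableSet f) := fun a b ha hb =>
    Set.disjoint_left.2 fun x hx => hball (by
      rw [Metric.mem_ball, Real.dist_eq, abs_lt]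
      constructor <;> linarith [hx.1, hx.2])
  have hint : ∀ a b, a ≤ b → θ - r < a → b < θ + r → IntervalIntegrable f volume a b :=
    fun a b hab ha hb => (intervalIntegrable_iff_integrableOn_Icc_of_le hab).2
      (hloc.2 a b (hdisj a b ha hb))
  obtain ⟨δ, hδ, hδr⟩ := exists_between (lt_min hr Real.pi_pos)
  have hδr' := hδr.trans_le (min_le_left _ _)
  refine ⟨δ, hδ, hδr.trans_le (min_le_right _ _), hdisj _ _ (by linarith) (by linarith),
    hint _ _ (by linarith) (by linarith) (by linarith), ?_⟩
  obtain ⟨p, hp1, hp2⟩ := exists_rat_btwn (show θ - r < θ by linarith)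
  obtain ⟨q, hq1, hq2⟩ := exists_rat_btwn (show θ < θ + r by linarith)
  have hmem : θ ∈ Set.uIcc (p : ℝ) q := by
    rw [Set.uIcc_of_le (by linarith)]
    exact ⟨hp2.le, hq1.le⟩
  exact hθ2 p q (hint _ _ (by linarith) hp1 hq2) hmem θ hmem

/-! ### Radial limits -/

lemma IsIteratedPiecewisePrimitive.periodic {S : Set ℝ} {n : ℕ} {F g : ℝ → ℝ}
    (h : IsIteratedPiecewisePrimitive S n F g) (hg : Function.Periodic g (2 * Real.pi)) :
    Function.Periodic F (2 * Real.pi) := by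
  cases n with
  | zero => rwa [show F = g from h]
  | succ n =>
    obtain ⟨H, -, hF, -⟩ := h
    exact hF

/-- Radial limits of the angular derivatives of the inner analytic function of a piecewise
primitive. -/
lemma tendsto_re_iterate_angularDeriv {S : Set ℝ} {g F : ℝ → ℝ} {n : ℕ} {θ δ : ℝ}
    (hg : Function.Periodic g (2 * Real.pi)) (hF : IsIteratedPiecewisePrimitive S n F g)
    (hFi : IntervalIntegrable F volume (-Real.pi) Real.pi) (hδ : 0 < δ) (hδ' : δ < Real.pi)
    (hS : Disjoint (Set.Icc (θ - δ) (θ + δ)) S)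
    (hgi : IntervalIntegrable g volume (θ - δ) (θ + δ))
    (hd : HasDerivAt (fun x => ∫ t in θ..x, g t) (g θ) θ) :
    Tendsto (fun ρ => (angularDeriv^[n] (innerAnalyticOfIntegrable F) (polarPoint ρ θ)).re)
      (𝓝[<] 1) (𝓝 (g θ)) := by
  have hpi := Real.pi_pos
  have hFper := hF.periodic hg
  have hFint : ∀ a b, IntervalIntegrable F volume a b :=
    hFper.intervalIntegrable Real.two_pi_pos.ne' (t := -Real.pi) (by
      rwa [show -Real.pi + 2 * Real.pi = Real.pi by ring])
  have hne : ∀ s : ℝ, |s| = δ → polarPoint 1 s ≠ 1 := fun s hs =>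
    polarPoint_one_ne_one (by rw [hs]; exact hδ) (by rw [hs]; linarith)
  have h0 := tendsto_integral_poissonDeriv_of_primitive (by linarith) hS
    (hne _ (by rw [sub_sub_cancel, abs_of_pos hδ]))
    (hne _ (by rw [sub_add_cancel_left, abs_neg, abs_of_pos hδ]))
    (tendsto_integral_poissonDeriv_zero_mul hδ hδ'.le hgi hd) n hF
  -- The outer arcs may contain singularities of `g`; there only the integrability of `F` is used.
  have h1 := tendsto_integral_poissonDeriv_away n (θ := θ) (hFint (θ - Real.pi) (θ - δ))
    fun φ hφ => by
      rw [Set.uIcc_of_le (by linarith)] at hφ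
      have : 0 < θ - φ := by linarith [hφ.2]
      exact polarPoint_one_ne_one (abs_pos.2 this.ne') (by rw [abs_of_pos this]; linarith [hφ.1])
  have h2 := tendsto_integral_poissonDeriv_away n (θ := θ) (hFint (θ + δ) (θ + Real.pi))
    fun φ hφ => by
      rw [Set.uIcc_of_le (by linarith)] at hφ
      have : θ - φ < 0 := by linarith [hφ.1]
      exact polarPoint_one_ne_one (abs_pos.2 this.ne) (by rw [abs_of_neg this]; linarith [hφ.2])
  have h3 := (h1.add (h0.add h2)).const_mul (2 * Real.pi)⁻¹
  rw [zero_add, add_zero, inv_mul_cancel_left₀ Real.two_pi_pos.ne'] at h3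
  refine h3.congr' ?_
  filter_upwards [eventually_abs_lt_one_nhdsLT] with ρ hρ
  have hi : ∀ a b, IntervalIntegrable (fun φ => poissonDeriv n ρ (θ - φ) * F φ) volume a b :=
    fun a b => (hFint a b).continuousOn_mul
      ((continuous_poissonDeriv n hρ.2.2).comp (by fun_prop)).continuousOn
  have hper : Function.Periodic (fun φ => poissonDeriv n ρ (θ - φ) * F φ) (2 * Real.pi) :=
    fun φ => by
      simp only [hFper φ]
      rw [← periodic_poissonDeriv n ρ (θ - (φ + 2 * Real.pi)),
        show θ - (φ + 2 * Real.pi) + 2 * Real.pi = θ - φ by ring]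
  -- Periodicity moves the period `[-π, π]` of the representation to the one centred at `θ`.
  have hshift := hper.intervalIntegral_add_eq (θ - Real.pi) (-Real.pi)
  rw [show θ - Real.pi + 2 * Real.pi = θ + Real.pi by ring,
    show -Real.pi + 2 * Real.pi = Real.pi by ring] at hshift
  rw [intervalIntegral.integral_add_adjacent_intervals (hi _ _) (hi _ _),
    intervalIntegral.integral_add_adjacent_intervals (hi _ _) (hi _ _), hshift,
    ← re_iterate_angularDeriv_innerAnalytic hFi n hρ.2.2, inv_mul_cancel_left₀ Real.two_pi_pos.ne']

end DiskDirichlet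

end

theorem theorem2 (f : ℝ → ℝ) (hper : Function.Periodic f (2 * Real.pi))
    (hloc : DiskDirichlet.LocallyIntegrableAE f)
    (w : ℂ → ℂ) (hw : DiskDirichlet.IsInnerAnalyticOf f w)
    (hfin : {z : ℂ | DiskDirichlet.IsHardSingularity w z}.Finite)
    (hdeg : ∀ z : ℂ, DiskDirichlet.IsHardSingularity w z →
      ∃ n : ℕ, DiskDirichlet.HasDegreeOfHardness w z n) :
    ∃ u : ℂ → ℝ,
      InnerProductSpace.HarmonicOnNhd u (Metric.ball 0 1) ∧
      (∀ z ∈ Metric.ball (0 : ℂ) 1, u z = (w z).re) ∧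
      ∀ᵐ θ : ℝ, Tendsto (fun ρ : ℝ => u (ρ * Complex.exp (θ * Complex.I)))
        (𝓝[<] 1) (𝓝 (f θ)) := by
  obtain ⟨c, n, F, hF, hFi, hwF⟩ := hw
  have han : AnalyticOnNhd ℂ w (Metric.ball 0 1) := by
    refine AnalyticOnNhd.congr Metric.isOpen_ball ?_ hwF.symm
    exact analyticOnNhd_const.add (DiskDirichlet.analyticOnNhd_iterate_angularDeriv
      (DiskDirichlet.analyticOnNhd_innerAnalytic hFi) n)
  refine ⟨fun z => (w z).re, fun z hz => (han z hz).harmonicAt_re, fun z _ => rfl, ?_⟩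
  filter_upwards [DiskDirichlet.ae_exists_hasDerivAt_integral hper hloc] with θ hθ
  obtain ⟨δ, hδ, hδ', hS, hfi, hd⟩ := hθ
  have hd' : HasDerivAt (fun x => ∫ t in θ..x, (f t - c)) (f θ - c) θ := by
    have h1 := hd.sub (((hasDerivAt_id θ).sub_const θ).mul_const c)
    rw [one_mul] at h1
    refine h1.congr_of_eventuallyEq ?_
    -- Splitting the integral needs `f` integrable between `θ` and `x`, which is known only for `x`
    -- near `θ`.
    filter_upwards [Icc_mem_nhds (by linarith : θ - δ < θ) (by linarith : θ < θ + δ)] with x hx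
    have hfx : IntervalIntegrable f volume θ x := hfi.mono_set (by
      rw [Set.uIcc_of_le (by linarith : θ - δ ≤ θ + δ)]
      exact Set.uIcc_subset_Icc ⟨by linarith, by linarith⟩ hx)
    rw [intervalIntegral.integral_sub hfx intervalIntegrable_const,
      intervalIntegral.integral_const]
    simp
  have h := (DiskDirichlet.tendsto_re_iterate_angularDeriv
    (fun x => by simp only [hper x]) hF hFi hδ hδ' hS (hfi.sub intervalIntegrable_const)
    hd').const_add c
  rw [add_sub_cancel] at h
  refine h.congr' ?_
  filter_upwards [DiskDirichlet.eventually_abs_lt_one_nhdsLT] with ρ hρ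
  have hmem : DiskDirichlet.polarPoint ρ θ ∈ Metric.ball (0 : ℂ) 1 := by
    rw [mem_ball_zero_iff, DiskDirichlet.norm_polarPoint]
    exact hρ.2.2
  have := congrArg Complex.re (hwF hmem)
  rw [Complex.add_re, Complex.ofReal_re] at this
  exact this.symm
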